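/- Let $K$ be a field of characteristic zero. Let $x$, $\partial=\frac{d}{dx}$ and $\int: x^m\mapsto \frac{x^{m+1}}{m+1}$ $(m\ge 0)$ act as $K$-linear endomorphisms of the polynomial algebra $K[x]$ ($x$ acting by multiplication), let $\mathbb I_1=K\langle x,\partial,\int\rangle\subseteq \mathrm{End}_K(K[x])$ be the algebra of polynomial integro-differential operators, and let $\mathbb I_n=\mathbb I_1^{\otimes n}$ (tensor product over $K$). For a ring $R$, let $\mathcal C_R$ be the set of its regular elements (non-zero-divisors, on both sides). A multiplicative set $S\subseteq R$ is a left Ore set if for all $r\in R$, $s\in S$ there are $s'\in S$, $r'\in R$ with $s'r=r's$; right Ore sets are defined symmetrically. The classical left (resp. right) quotient ring $Q_{l,cl}(R)=\mathcal C_R^{-1}R$ (resp. $Q_{r,cl}(R)=R\,\mathcal C_R^{-1}$) is the ring of left (resp. right) fractions of $R$ with denominators in $\mathcal C_R$, if it exists. Let $S_l(R)$ (resp. $S_r(R)$) be the largest left (resp. right) Ore set of $R$ contained in $\mathcal C_R$, and let $Q_l(R)=S_l(R)^{-1}R$ and $Q_r(R)=R\,S_r(R)^{-1}$ be the largest left and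 right quotient rings of $R$. Let $A$ be a nonzero associative unital $K$-algebra, let $n\ge 1$, and let $R=\mathbb I_n\otimes_K A$. Then: 1. The set $\mathcal C_R$ is neither a left Ore set nor a right Ore set of $R$, and neither of the rings $Q_{l,cl}(R)$ and $Q_{r,cl}(R)$ exists. 2. The ring $Q_l(R)$ contains an infinite direct sum of nonzero left ideals, and so it is not left Noetherian. The ring $Q_r(R)$ contains an infinite direct sum of nonzero right ideals, and so it is not right Noetherian. -/

import Mathlib

open scoped TensorProduct Polynomial nonZeroDivisors

namespace IntegroDiff

/-! ### Ore sets and quotient rings -/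

section Ore

variable {R : Type*} [Ring R]

/-- A multiplicative subset `S` of a ring is a left Ore set if for all `r ∈ R` and `s ∈ S` there
are `s' ∈ S` and `r' ∈ R` with `s' r = r' s`. (Some authors also require `0 ∉ S`; when `R ≠ 0` and
`S` consists of regular elements this holds automatically.) -/
def IsLeftOre (S : Submonoid R) : Prop :=
  ∀ r : R, ∀ s ∈ S, ∃ s' ∈ S, ∃ r' : R, s' * r = r' * s

/-- A multiplicative subset `S` of a ring is a right Ore set if for all `r ∈ R` and `s ∈ S` there
are `s' ∈ S` and `r' ∈ R` with `r s' = s r'`. -/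
def IsRightOre (S : Submonoid R) : Prop :=
  ∀ r : R, ∀ s ∈ S, ∃ s' ∈ S, ∃ r' : R, r * s' = s * r'

/-- `f : R → Q` exhibits `Q` as the left quotient ring `S⁻¹R`: elements of `S` become units, every
element of `Q` is a left fraction `f(s)⁻¹ f(r)`, and the kernel is `{r | s r = 0 for some s ∈ S}`. -/
structure IsLeftQuotientRing (S : Submonoid R) {Q : Type*} [Ring Q] (f : R →+* Q) : Prop where
  isUnit : ∀ s ∈ S, IsUnit (f s)
  exists_frac : ∀ q : Q, ∃ s ∈ S, ∃ r : R, f s * q = f r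
  map_eq_zero_iff : ∀ r : R, f r = 0 ↔ ∃ s ∈ S, s * r = 0

/-- `f : R → Q` exhibits `Q` as the right quotient ring `RS⁻¹`: elements of `S` become units, every
element of `Q` is a right fraction `f(r) f(s)⁻¹`, and the kernel is
`{r | r s = 0 for some s ∈ S}`. -/
structure IsRightQuotientRing (S : Submonoid R) {Q : Type*} [Ring Q] (f : R →+* Q) : Prop where
  isUnit : ∀ s ∈ S, IsUnit (f s)
  exists_frac : ∀ q : Q, ∃ s ∈ S, ∃ r : R, q * f s = f r
  map_eq_zero_iff : ∀ r : R, f r = 0 ↔ ∃ s ∈ S, r * s = 0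

theorem isLeftOre_sSup {T : Set (Submonoid R)} (hT : ∀ S ∈ T, IsLeftOre S) :
    IsLeftOre (sSup T) := by
  intro r s hs
  rw [sSup_eq_iSup', Submonoid.iSup_eq_closure] at hs
  induction hs using Submonoid.closure_induction generalizing r with
  | mem s hs =>
    obtain ⟨S, hS⟩ := Set.mem_iUnion.1 hs
    obtain ⟨s', hs', r', h⟩ := hT S S.2 r s hS
    exact ⟨s', Submonoid.mem_sSup_of_mem S.2 hs', r', h⟩
  | one => exact ⟨1, one_mem _, r, by simp⟩
  | mul x y _ _ hx hy =>
    obtain ⟨y', hy', r₁, h₁⟩ := hy r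
    obtain ⟨x', hx', r₂, h₂⟩ := hx r₁
    exact ⟨x' * y', mul_mem hx' hy', r₂, by rw [mul_assoc, h₁, ← mul_assoc, h₂, mul_assoc]⟩

theorem isRightOre_sSup {T : Set (Submonoid R)} (hT : ∀ S ∈ T, IsRightOre S) :
    IsRightOre (sSup T) := by
  intro r s hs
  rw [sSup_eq_iSup', Submonoid.iSup_eq_closure] at hs
  induction hs using Submonoid.closure_induction generalizing r with
  | mem s hs =>
    obtain ⟨S, hS⟩ := Set.mem_iUnion.1 hs
    obtain ⟨s', hs', r', h⟩ := hT S S.2 r s hS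
    exact ⟨s', Submonoid.mem_sSup_of_mem S.2 hs', r', h⟩
  | one => exact ⟨1, one_mem _, r, by simp⟩
  | mul x y _ _ hx hy =>
    obtain ⟨x', hx', r₁, h₁⟩ := hx r
    obtain ⟨y', hy', r₂, h₂⟩ := hy r₁
    exact ⟨x' * y', mul_mem hx' hy', r₂, by rw [← mul_assoc, h₁, mul_assoc, h₂, mul_assoc]⟩

variable (R)

/-- `S_l(R)`, the largest left Ore set of `R` that consists of regular elements. -/
def largestLeftOre : Submonoid R :=
  sSup {S : Submonoid R | IsLeftOre S ∧ S ≤ R⁰}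

/-- `S_r(R)`, the largest right Ore set of `R` that consists of regular elements. -/
def largestRightOre : Submonoid R :=
  sSup {S : Submonoid R | IsRightOre S ∧ S ≤ R⁰}

theorem isGreatest_largestLeftOre :
    IsGreatest {S : Submonoid R | IsLeftOre S ∧ S ≤ R⁰} (largestLeftOre R) :=
  ⟨⟨isLeftOre_sSup fun _ h => h.1, sSup_le fun _ h => h.2⟩, fun _ h => le_sSup h⟩

theorem isGreatest_largestRightOre :
    IsGreatest {S : Submonoid R | IsRightOre S ∧ S ≤ R⁰} (largestRightOre R) :=
  ⟨⟨isRightOre_sSup fun _ h => h.1, sSup_le fun _ h => h.2⟩, fun _ h => le_sSup h⟩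

noncomputable instance oreSetLargestLeftOre : OreLocalization.OreSet (largestLeftOre R) :=
  Classical.choice <| OreLocalization.nonempty_oreSet_iff.2 <| by
    obtain ⟨hO, hR⟩ := (isGreatest_largestLeftOre R).1
    refine ⟨fun r₁ r₂ s h => ⟨1, ?_⟩, fun r s => ?_⟩
    · have h0 : (r₁ - r₂) * (s : R) = 0 := by rw [sub_mul, h, sub_self]
      rw [sub_eq_zero.1 ((hR s.2).2 _ h0)]
    · obtain ⟨s', hs', r', h⟩ := hO r s s.2
      exact ⟨r', ⟨s', hs'⟩, h⟩

noncomputable instance oreSetOpLargestRightOre :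
    OreLocalization.OreSet (largestRightOre R).op :=
  Classical.choice <| OreLocalization.nonempty_oreSet_iff.2 <| by
    obtain ⟨hO, hR⟩ := (isGreatest_largestRightOre R).1
    refine ⟨fun r₁ r₂ s h => ⟨1, ?_⟩, fun r s => ?_⟩
    · have h0 : (s : Rᵐᵒᵖ).unop * (r₁ - r₂).unop = 0 := by
        rw [← MulOpposite.unop_mul, sub_mul, h, sub_self, MulOpposite.unop_zero]
      rw [sub_eq_zero.1 (MulOpposite.unop_eq_zero_iff _ |>.1 ((hR s.2).1 _ h0))]
    · obtain ⟨s', hs', r', h⟩ := hO r.unop (s : Rᵐᵒᵖ).unop s.2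
      exact ⟨MulOpposite.op r', ⟨MulOpposite.op s', hs'⟩, MulOpposite.unop_injective h⟩

/-- The largest left quotient ring `Q_l(R) = S_l(R)⁻¹R`. -/
abbrev LeftQuotientRing : Type _ :=
  OreLocalization (largestLeftOre R) R

/-- The largest right quotient ring `Q_r(R) = R S_r(R)⁻¹`: the opposite of the left localization
of `Rᵐᵒᵖ` at `S_r(R)`. -/
abbrev RightQuotientRing : Type _ :=
  (OreLocalization (largestRightOre R).op Rᵐᵒᵖ)ᵐᵒᵖ

end Ore

/-! ### Polynomial integro-differential operators -/

section Operators

variable (K : Type*) [Field K]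

/-- Integration on `K[x]`: the linear map `xⁿ ↦ xⁿ⁺¹ / (n + 1)`. -/
noncomputable def integral : Module.End K K[X] :=
  Polynomial.lsum fun n => ((n : K) + 1)⁻¹ • Polynomial.monomial (n + 1)

/-- The algebra `𝕀₁ = K⟨x, d/dx, ∫⟩` of polynomial integro-differential operators in one variable,
a subalgebra of `End_K(K[x])`. -/
noncomputable def I₁ : Subalgebra K (Module.End K K[X]) :=
  Algebra.adjoin K {LinearMap.mulLeft K Polynomial.X, Polynomial.derivative, integral K}

/-- The algebra `𝕀ₙ = 𝕀₁ ⊗ ⋯ ⊗ 𝕀₁` (`n` factors, over `K`). -/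
noncomputable def I (n : ℕ) : Type _ :=
  ⨂[K] _ : Fin n, I₁ K

/-- The usual ring structure on a tensor product of algebras. -/
noncomputable instance instRingI (n : ℕ) : Ring (I K n) :=
  PiTensorProduct.instRing (R := K) (A := fun _ : Fin n => I₁ K)

/-- The usual algebra structure on a tensor product of algebras. -/
noncomputable instance instAlgebraI (n : ℕ) : Algebra K (I K n) :=
  PiTensorProduct.instAlgebra (R' := K) (R := K) (A := fun _ : Fin n => I₁ K)

end Operators

end IntegroDiff

namespace IntegroDiff

/-! ### Classical quotient rings and Ore sets -/

section Classical

variable {R : Type*} [Ring R]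

/-! Let `e = 1 - ∫∂`, the projection `p ↦ p(0)` of `K[x]` onto constants. In `𝕀₁` the elements `1 -
∂` and `1 - x` are regular, yet `𝕀₁e ∩ 𝕀₁(1 - ∂) = 0` and `e𝕀₁ ∩ (1 - x)𝕀₁ = 0`, so the left and
right Ore conditions fail. The first intersection vanishes because `r(1 - ∂) = ae` forces `r(xᵐ) =
m! a(1)`, whereas an operator in `𝕀₁` lowers the order of vanishing at `0` by a bounded amount
(`exists_X_pow_dvd_apply`). The second vanishes because a constant divisible by `1 - x` is zero.

As an `𝕀₁`-bimodule, `𝕀ₙ ⊗ A` is a direct sum of copies of `𝕀₁`; the coordinate maps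
(`IsBimoduleSeparated`) carry regularity and the failure of Ore over to it. A classical quotient
ring would force the Ore condition.

Since `∂∫ = 1` and `e ≠ 0`, the elements `∫ⁱ e ∂ⁱ` are nonzero orthogonal idempotents. They stay
nonzero in the largest quotient rings, whose denominators are regular, and generate infinite direct
sums there. -/

theorem IsLeftQuotientRing.isLeftOre {Q : Type*} [Ring Q] {f : R →+* Q}
    (hf : IsLeftQuotientRing R⁰ f) : IsLeftOre R⁰ := by
  intro r s hs
  obtain ⟨u, hu⟩ := hf.isUnit s hs
  obtain ⟨s', hs', r', h⟩ := hf.exists_frac (f r * ↑u⁻¹)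
  refine ⟨s', hs', r', ?_⟩
  have h0 : f (s' * r - r' * s) = 0 := by
    rw [map_sub, map_mul, map_mul, ← h, ← hu, mul_assoc, mul_assoc, Units.inv_mul, mul_one, sub_self]
  obtain ⟨t, ht, h1⟩ := (hf.map_eq_zero_iff _).1 h0
  exact sub_eq_zero.1 (ht.1 _ h1)

theorem IsRightQuotientRing.isRightOre {Q : Type*} [Ring Q] {f : R →+* Q}
    (hf : IsRightQuotientRing R⁰ f) : IsRightOre R⁰ := by
  intro r s hs
  obtain ⟨u, hu⟩ := hf.isUnit s hs
  obtain ⟨s', hs', r', h⟩ := hf.exists_frac (↑u⁻¹ * f r)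
  refine ⟨s', hs', r', ?_⟩
  have h0 : f (r * s' - s * r') = 0 := by
    rw [map_sub, map_mul, map_mul, ← h, ← hu, mul_assoc, Units.mul_inv_cancel_left, sub_self]
  obtain ⟨t, ht, h1⟩ := (hf.map_eq_zero_iff _).1 h0
  exact sub_eq_zero.1 (ht.2 _ h1)

end Classical

/-! ### Orthogonal idempotents and direct sums of ideals -/

section Idempotents

/-- `f i` is the identity on the `i`-th span and kills all the others. Stated for modules so as to
serve left and right ideals alike. -/
theorem iSupIndep_span_singleton_of_projections {R M ι : Type*} [Ring R] [AddCommGroup M]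
    [Module R M] (v : ι → M) (f : ι → M →ₗ[R] M) (hf : ∀ i, f i (v i) = v i)
    (hf' : ∀ i j, j ≠ i → f i (v j) = 0) : iSupIndep fun i => Submodule.span R {v i} := by
  intro i
  rw [Submodule.disjoint_def]
  intro x hx hx'
  obtain ⟨c, rfl⟩ := Submodule.mem_span_singleton.1 hx
  have hle : ⨆ j, ⨆ (_ : j ≠ i), Submodule.span R {v j} ≤ LinearMap.ker (f i) :=
    iSup₂_le fun j hj => by
      rw [Submodule.span_singleton_le_iff_mem]
      exact hf' i j hj
  have h0 := LinearMap.mem_ker.1 (hle hx')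
  rwa [map_smul, hf] at h0

variable {R : Type*} [Ring R] {E : ℕ → R}

theorem _root_.OrthogonalIdempotents.iSupIndep_span (hE : OrthogonalIdempotents E) :
    iSupIndep fun i => Ideal.span {E i} :=
  iSupIndep_span_singleton_of_projections E (fun i => LinearMap.toSpanSingleton R R (E i))
    (fun i => (hE.idem i).eq) fun _ _ hij => hE.ortho hij

theorem _root_.OrthogonalIdempotents.iSupIndep_span_op (hE : OrthogonalIdempotents E) :
    iSupIndep fun i => Submodule.span Rᵐᵒᵖ {E i} :=
  iSupIndep_span_singleton_of_projections E (fun i => DistribSMul.toLinearMap Rᵐᵒᵖ R (E i))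
    (fun i => (hE.idem i).eq) fun _ _ hij => hE.ortho hij.symm

theorem not_isNoetherian_of_iSupIndep {M : Type*} [AddCommGroup M] [Module R M]
    {L : ℕ → Submodule R M} (h0 : ∀ i, L i ≠ ⊥) (hL : iSupIndep L) : ¬ IsNoetherian R M := fun _ =>
  (WellFoundedGT.finite_of_iSupIndep hL h0).false

/-- The matrix units `eᵢᵢ = bⁱ (1 - b a) aⁱ` attached to elements with `a b = 1`. -/
def diagonalUnit (a b : R) (i : ℕ) : R := b ^ i * (1 - b * a) * a ^ i

variable {a b : R}

theorem pow_mul_pow_of_mul_eq_one (h : a * b = 1) (i : ℕ) : a ^ i * b ^ i = 1 := by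
  induction i with
  | zero => simp
  | succ i ih => rw [pow_succ, pow_succ', mul_assoc, ← mul_assoc a, h, one_mul, ih]

/-- `aⁱbʲ` collapses to a positive power of `a` or of `b`, and `a(1 - ba) = 0 = (1 - ba)b`. -/
theorem one_sub_mul_pow_mul_pow_mul_one_sub (h : a * b = 1) {i j : ℕ} (hij : i ≠ j) :
    (1 - b * a) * (a ^ i * b ^ j) * (1 - b * a) = 0 := by
  have ha : a * (1 - b * a) = 0 := by rw [mul_sub, mul_one, ← mul_assoc, h, one_mul, sub_self]
  have hb : (1 - b * a) * b = 0 := by rw [sub_mul, one_mul, mul_assoc, h, mul_one, sub_self]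
  rcases lt_or_gt_of_ne hij with hlt | hlt
  · obtain ⟨k, rfl⟩ := Nat.exists_eq_add_of_lt hlt
    rw [add_assoc, pow_add, ← mul_assoc (a ^ i), pow_mul_pow_of_mul_eq_one h, one_mul, pow_succ',
      ← mul_assoc, hb, zero_mul, zero_mul]
  · obtain ⟨k, rfl⟩ := Nat.exists_eq_add_of_lt hlt
    rw [add_assoc, add_comm, pow_add, mul_assoc (a ^ _), pow_mul_pow_of_mul_eq_one h, mul_one,
      mul_assoc, pow_succ, mul_assoc, ha, mul_zero, mul_zero]

theorem orthogonalIdempotents_diagonalUnit (h : a * b = 1) :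
    OrthogonalIdempotents (diagonalUnit a b) where
  idem i := by
    have he : (1 - b * a) * (1 - b * a) = 1 - b * a := by
      rw [mul_sub, mul_one, sub_mul, one_mul, mul_assoc, ← mul_assoc a, h, one_mul, sub_self,
        sub_zero]
    calc b ^ i * (1 - b * a) * a ^ i * (b ^ i * (1 - b * a) * a ^ i)
        = b ^ i * (1 - b * a) * (a ^ i * b ^ i) * (1 - b * a) * a ^ i := by
          simp only [mul_assoc]
      _ = b ^ i * (1 - b * a) * a ^ i := by
          rw [pow_mul_pow_of_mul_eq_one h, mul_one, mul_assoc (b ^ i), he]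
  ortho i j hij := by
    calc b ^ i * (1 - b * a) * a ^ i * (b ^ j * (1 - b * a) * a ^ j)
        = b ^ i * ((1 - b * a) * (a ^ i * b ^ j) * (1 - b * a)) * a ^ j := by
          simp only [mul_assoc]
      _ = 0 := by rw [one_sub_mul_pow_mul_pow_mul_one_sub h hij, mul_zero, zero_mul]

theorem diagonalUnit_ne_zero (h : a * b = 1) (he : 1 - b * a ≠ 0) (i : ℕ) :
    diagonalUnit a b i ≠ 0 := by
  intro h0
  apply he
  calc 1 - b * a = (a ^ i * b ^ i) * (1 - b * a) * (a ^ i * b ^ i) := by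
        rw [pow_mul_pow_of_mul_eq_one h, one_mul, mul_one]
    _ = a ^ i * diagonalUnit a b i * b ^ i := by simp only [diagonalUnit, mul_assoc]
    _ = 0 := by rw [h0, mul_zero, zero_mul]

theorem exists_iSupIndep_leftQuotientRing (hE : OrthogonalIdempotents E) (h0 : ∀ i, E i ≠ 0) :
    ∃ L : ℕ → Ideal (LeftQuotientRing R), (∀ i, L i ≠ ⊥) ∧ iSupIndep L := by
  refine ⟨_, fun i => ?_,
    (hE.map (OreLocalization.numeratorRingHom (S := largestLeftOre R))).iSupIndep_span⟩
  rw [Ne, Ideal.span_singleton_eq_bot]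
  refine fun h => h0 i (OreLocalization.numeratorHom_inj (S := largestLeftOre R)
    (fun s hs => ((isGreatest_largestLeftOre R).1.2 hs).1) (h.trans (map_zero
      (OreLocalization.numeratorRingHom (S := largestLeftOre R))).symm))

theorem exists_iSupIndep_rightQuotientRing (hE : OrthogonalIdempotents E) (h0 : ∀ i, E i ≠ 0) :
    ∃ L : ℕ → Submodule (RightQuotientRing R)ᵐᵒᵖ (RightQuotientRing R),
      (∀ i, L i ≠ ⊥) ∧ iSupIndep L := by
  let g := OreLocalization.numeratorRingHom (S := (largestRightOre R).op)
  have hg : Function.Injective g := OreLocalization.numeratorHom_inj fun s hs r hr =>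
    MulOpposite.unop_injective
      (((isGreatest_largestRightOre R).1.2 hs).2 _ (congrArg MulOpposite.unop hr))
  -- The numerator map starts at `Rᵐᵒᵖ`, so its opposite is precomposed with `R ≃ Rᵐᵒᵖᵐᵒᵖ`.
  let f : R →+* RightQuotientRing R := g.op.comp (RingEquiv.opOp R).toRingHom
  have hf : Function.Injective f := fun x y h =>
    MulOpposite.op_injective (hg (MulOpposite.op_injective h))
  refine ⟨_, fun i => ?_, (hE.map f).iSupIndep_span_op⟩
  rw [Ne, Submodule.span_singleton_eq_bot]
  exact (map_ne_zero_iff f hf).2 (h0 i)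

end Idempotents

/-! ### Regular elements and Ore conditions in scalar extensions -/

section Bimodule

variable {K : Type*} [Field K]

/-- An algebra map `j : S → R` for which the `S`-bimodule maps `R → S` separate the points
of `R`. -/
def IsBimoduleSeparated {S R : Type*} [Ring S] [Algebra K S] [Ring R] [Algebra K R]
    (j : S →ₐ[K] R) : Prop :=
  ∀ t : R, t ≠ 0 → ∃ π : R →ₗ[K] S, π t ≠ 0 ∧ (∀ a u, π (j a * u) = a * π u) ∧
    ∀ a u, π (u * j a) = π u * a

variable {S R T : Type*} [Ring S] [Algebra K S] [Ring R] [Algebra K R] [Ring T] [Algebra K T]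

theorem IsBimoduleSeparated.comp {j : S →ₐ[K] R} {k : R →ₐ[K] T} (hk : IsBimoduleSeparated k)
    (hj : IsBimoduleSeparated j) : IsBimoduleSeparated (k.comp j) := by
  intro t ht
  obtain ⟨π, h, hl, hr⟩ := hk t ht
  obtain ⟨ρ, h', hl', hr'⟩ := hj _ h
  exact ⟨ρ.comp π, h', fun a u => by simp [hl, hl'], fun a u => by simp [hr, hr']⟩

theorem IsBimoduleSeparated.map_mem_nonZeroDivisors {j : S →ₐ[K] R} (hj : IsBimoduleSeparated j)
    {s : S} (hs : s ∈ S⁰) : j s ∈ R⁰ := by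
  constructor
  · intro t ht
    by_contra h0
    obtain ⟨π, h, hl, -⟩ := hj t h0
    exact h (hs.1 _ (by rw [← hl, ht, map_zero]))
  · intro t ht
    by_contra h0
    obtain ⟨π, h, -, hr⟩ := hj t h0
    exact h (hs.2 _ (by rw [← hr, ht, map_zero]))

/-- The hypothesis `h` says `Se ∩ Ss = 0`. An Ore relation `s' j(e) = r' j(s)` is sent by each
bimodule map into this intersection, so `s' j(e) = 0`, against the regularity of `s'`. -/
theorem IsBimoduleSeparated.not_isLeftOre {j : S →ₐ[K] R} (hj : IsBimoduleSeparated j) {e s : S}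
    (he : j e ≠ 0) (hs : s ∈ S⁰) (h : ∀ a r : S, a * e = r * s → a * e = 0) :
    ¬ IsLeftOre R⁰ := by
  intro hO
  obtain ⟨s', hs', r', h1⟩ := hO (j e) _ (hj.map_mem_nonZeroDivisors hs)
  refine he (hs'.1 _ ?_)
  by_contra h0
  obtain ⟨π, h2, -, hr⟩ := hj _ h0
  refine h2 ?_
  rw [hr]
  exact h _ (π r') (by rw [← hr, ← hr, h1])

theorem IsBimoduleSeparated.not_isRightOre {j : S →ₐ[K] R} (hj : IsBimoduleSeparated j) {e s : S}
    (he : j e ≠ 0) (hs : s ∈ S⁰) (h : ∀ a r : S, e * a = s * r → e * a = 0) :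
    ¬ IsRightOre R⁰ := by
  intro hO
  obtain ⟨s', hs', r', h1⟩ := hO (j e) _ (hj.map_mem_nonZeroDivisors hs)
  refine he (hs'.2 _ ?_)
  by_contra h0
  obtain ⟨π, h2, hl, -⟩ := hj _ h0
  refine h2 ?_
  rw [hl]
  exact h _ (π r') (by rw [← hl, ← hl, h1])

theorem exists_orthogonalIdempotents_of_mul_eq_one (j : S →ₐ[K] R) {a b : S} (h : a * b = 1)
    (he : j (1 - b * a) ≠ 0) : ∃ E : ℕ → R, OrthogonalIdempotents E ∧ ∀ i, E i ≠ 0 := by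
  have hj : j a * j b = 1 := by rw [← map_mul, h, map_one]
  rw [map_sub, map_one, map_mul] at he
  exact ⟨_, orthogonalIdempotents_diagonalUnit hj, diagonalUnit_ne_zero hj he⟩

/-- Coordinates along a `K`-basis of `A` are `S`-bimodule maps. -/
theorem isBimoduleSeparated_includeLeft (S A : Type*) [Ring S] [Algebra K S] [Ring A]
    [Algebra K A] :
    IsBimoduleSeparated (Algebra.TensorProduct.includeLeft : S →ₐ[K] S ⊗[K] A) := by
  classical
  intro t ht
  let b := Module.Free.chooseBasis K A
  let E := TensorProduct.equivFinsuppOfBasisRight (M := S) b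
  obtain ⟨i, hi⟩ := Finsupp.ne_iff.1 ((map_ne_zero_iff E E.injective).2 ht)
  refine ⟨(Finsupp.lapply i).comp E.toLinearMap, hi, fun a u => ?_, fun a u => ?_⟩ <;>
  induction u with
  | zero => simp
  | add x y hx hy => simp only [mul_add, add_mul, map_add, hx, hy]
  | tmul x y => simp [E]

theorem includeLeft_ne_zero {S : Type*} (A : Type*) [Ring S] [Algebra K S] [Ring A]
    [Algebra K A] [Nontrivial A] {a : S} (ha : a ≠ 0) :
    (Algebra.TensorProduct.includeLeft : S →ₐ[K] S ⊗[K] A) a ≠ 0 :=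
  (map_ne_zero_iff _ (Algebra.TensorProduct.includeLeft_injective (S := K)
    (algebraMap K A).injective)).2 ha

variable {ι : Type*} [DecidableEq ι] (A : ι → Type*) [∀ i, Ring (A i)] [∀ i, Algebra K (A i)]

theorem isBimoduleSeparated_singleAlgHom (i : ι) :
    IsBimoduleSeparated (PiTensorProduct.singleAlgHom (R := K) (A := A) i) := by
  intro t ht
  let b := Module.Free.chooseBasis K (⨂[K] (j : ({i}ᶜ : Set ι)), A j)
  let E := PiTensorProduct.equivPiTensorComplSingletonTensor K A i ≪≫ₗ
    TensorProduct.equivFinsuppOfBasisLeft (N := A i) b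
  obtain ⟨l, hl⟩ := Finsupp.ne_iff.1 ((map_ne_zero_iff E E.injective).2 ht)
  -- Multiplying by an element of the `i`-th factor leaves the complementary factors, hence the
  -- basis coordinates, untouched.
  have hone (a : A i) (k : ({i}ᶜ : Set ι)) : (Pi.mulSingle i a : ∀ k, A k) k = 1 :=
    Pi.mulSingle_eq_of_ne k.2 a
  refine ⟨(Finsupp.lapply l).comp E.toLinearMap, hl, fun a u => ?_, fun a u => ?_⟩ <;>
  induction u using PiTensorProduct.induction_on with
  | add x y hx hy => simp only [mul_add, add_mul, map_add, hx, hy]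
  | smul_tprod r x =>
    simp only [PiTensorProduct.singleAlgHom_apply, mul_smul_comm, smul_mul_assoc, map_smul,
      PiTensorProduct.tprod_mul_tprod]
    simp [E, hone]

-- A product of functionals, one nonvanishing on each `v i`, detects the pure tensor.
omit [DecidableEq ι] in
theorem tprod_ne_zero [Fintype ι] {A : ι → Type*} [∀ i, AddCommGroup (A i)] [∀ i, Module K (A i)]
    {v : ∀ i, A i} (hv : ∀ i, v i ≠ 0) : PiTensorProduct.tprod K v ≠ 0 := by
  have h (i) : ∃ φ : Module.Dual K (A i), φ (v i) ≠ 0 := by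
    by_contra! h
    exact hv i ((Module.forall_dual_apply_eq_zero_iff K _).1 h)
  choose φ hφ using h
  intro h0
  have h1 := congrArg
    (PiTensorProduct.lift ((MultilinearMap.mkPiAlgebra K ι K).compLinearMap φ)) h0
  rw [map_zero, PiTensorProduct.lift.tprod, MultilinearMap.compLinearMap_apply,
    MultilinearMap.mkPiAlgebra_apply] at h1
  exact Finset.prod_ne_zero_iff.2 (fun i _ => hφ i) h1

theorem singleAlgHom_ne_zero [Fintype ι] [∀ i, Nontrivial (A i)] (i : ι) {a : A i} (ha : a ≠ 0) :
    PiTensorProduct.singleAlgHom (R := K) (A := A) i a ≠ 0 := by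
  rw [PiTensorProduct.singleAlgHom_apply]
  refine tprod_ne_zero fun j => ?_
  rw [MonoidHom.mulSingle_apply]
  rcases eq_or_ne j i with rfl | hj
  · rwa [Pi.mulSingle_eq_same]
  · rw [Pi.mulSingle_eq_of_ne hj]
    exact one_ne_zero

end Bimodule

/-! ### Integro-differential operators in one variable -/

section OneVariable

open Polynomial

variable {K : Type*} [Field K]

theorem integral_X_pow (m : ℕ) : integral K (X ^ m) = C ((m : K) + 1)⁻¹ * X ^ (m + 1) := by
  rw [← monomial_one_right_eq_X_pow, integral, lsum_apply, sum_monomial_index _ _ (by simp),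
    LinearMap.smul_apply, smul_monomial, smul_eq_mul, mul_one, C_mul_X_pow_eq_monomial]

theorem integral_C_mul (c : K) (p : K[X]) : integral K (C c * p) = C c * integral K p := by
  rw [C_mul', map_smul, C_mul']

theorem end_ext {f g : Module.End K K[X]} (h : ∀ m : ℕ, f (X ^ m) = g (X ^ m)) : f = g :=
  lhom_ext' fun m => LinearMap.ext_ring (by simpa [monomial_one_right_eq_X_pow] using h m)

theorem X_pow_dvd_integral {k : ℕ} {p : K[X]} (h : X ^ k ∣ p) : X ^ k ∣ integral K p := by
  obtain ⟨q, rfl⟩ := h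
  induction q using Polynomial.induction_on' with
  | add p q hp hq => rw [mul_add, map_add]; exact dvd_add hp hq
  | monomial m c =>
    rw [← C_mul_X_pow_eq_monomial, mul_left_comm, ← pow_add, integral_C_mul, integral_X_pow]
    exact ((pow_dvd_pow X (by omega)).mul_left _).mul_left _

/-- Integro-differential operators lower the order of vanishing at `0` by a bounded amount. -/
theorem exists_X_pow_dvd_apply {a : Module.End K K[X]} (ha : a ∈ I₁ K) :
    ∃ d : ℕ, ∀ (k : ℕ) (p : K[X]), X ^ (k + d) ∣ p → X ^ k ∣ a p := by
  induction ha using Algebra.adjoin_induction with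
  | mem a ha =>
    refine ⟨1, fun k p hp => ?_⟩
    rcases ha with rfl | rfl | rfl
    · exact ((pow_dvd_pow X (Nat.le_succ k)).trans hp).mul_left _
    · obtain ⟨q, rfl⟩ := hp
      rw [derivative_mul, derivative_X_pow_succ]
      exact dvd_add (((dvd_mul_left _ _).mul_right _))
        ((pow_dvd_pow X (Nat.le_succ k)).mul_right _)
    · exact X_pow_dvd_integral ((pow_dvd_pow X (Nat.le_succ k)).trans hp)
  | algebraMap c =>
    refine ⟨0, fun k p hp => ?_⟩
    rw [Module.algebraMap_end_apply, ← C_mul']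
    exact hp.mul_left _
  | add a b _ _ ha hb =>
    obtain ⟨c, hc⟩ := ha
    obtain ⟨d, hd⟩ := hb
    refine ⟨c + d, fun k p hp => dvd_add (hc k p ?_) (hd k p ?_)⟩
    · exact (pow_dvd_pow X (by omega)).trans hp
    · exact (pow_dvd_pow X (by omega)).trans hp
  | mul a b _ _ ha hb =>
    obtain ⟨c, hc⟩ := ha
    obtain ⟨d, hd⟩ := hb
    exact ⟨c + d, fun k p hp => hc k _ (hd _ p (by rwa [add_assoc]))⟩

theorem eq_zero_of_forall_X_pow_dvd {p : K[X]} (h : ∀ k : ℕ, X ^ k ∣ p) : p = 0 := by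
  ext m
  exact X_pow_dvd_iff.1 (h (m + 1)) m (Nat.lt_succ_self m)

variable (K)

/-- Multiplication by `x`, as an element of `𝕀₁`. -/
noncomputable def mulX : I₁ K :=
  ⟨LinearMap.mulLeft K X, Algebra.subset_adjoin (by simp)⟩

/-- The derivation `d/dx`, as an element of `𝕀₁`. -/
noncomputable def deriv₁ : I₁ K :=
  ⟨derivative, Algebra.subset_adjoin (by simp)⟩

/-- Integration, as an element of `𝕀₁`. -/
noncomputable def integral₁ : I₁ K :=
  ⟨integral K, Algebra.subset_adjoin (by simp)⟩

variable {K}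

theorem I₁_ext {a b : I₁ K} (h : ∀ m : ℕ, a.1 (X ^ m) = b.1 (X ^ m)) : a = b :=
  Subtype.ext (end_ext h)

theorem one_sub_deriv₁_apply (p : K[X]) : (1 - deriv₁ K).1 p = p - derivative p := rfl

theorem one_sub_mulX_apply (p : K[X]) : (1 - mulX K).1 p = (1 - X) * p := by
  rw [sub_mul, one_mul]; rfl

theorem one_sub_mulX_mem_nonZeroDivisors : 1 - mulX K ∈ (I₁ K)⁰ := by
  have h1X : (1 - X : K[X]) ≠ 0 := sub_ne_zero.2 fun h => X_ne_C (1 : K) (h.symm.trans C_1.symm)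
  constructor
  · intro b hb
    refine I₁_ext fun m => ?_
    have h : (1 - X) * b.1 (X ^ m) = 0 := by
      rw [← one_sub_mulX_apply]
      exact congrArg (fun f : I₁ K => f.1 (X ^ m)) hb
    exact (mul_eq_zero.1 h).resolve_left h1X
  · intro b hb
    have h (m : ℕ) : b.1 (X ^ (m + 1)) = b.1 (X ^ m) := by
      have h : b.1 ((1 - mulX K).1 (X ^ m)) = 0 := congrArg (fun f : I₁ K => f.1 (X ^ m)) hb
      rw [one_sub_mulX_apply, sub_mul, one_mul, ← pow_succ', map_sub, sub_eq_zero] at h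
      exact h.symm
    have h' (m k : ℕ) : b.1 (X ^ (m + k)) = b.1 (X ^ m) := by
      induction k with
      | zero => rfl
      | succ k ih => rw [← add_assoc, h, ih]
    -- `b(xᵐ) = b(xᵐ⁺ᵏ⁺ᵈ)` is divisible by `xᵏ` for every `k`.
    obtain ⟨d, hd⟩ := exists_X_pow_dvd_apply b.2
    refine I₁_ext fun m => eq_zero_of_forall_X_pow_dvd fun k => ?_
    rw [← h' m (k + d)]
    exact hd k _ (pow_dvd_pow X (by omega))

/-- Vanishing on `xᵐ⁺¹` gives `r(xᵐ⁺¹) = (m + 1) r(xᵐ)`. The value at `1` is left free, so both `r(1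
- ∂) = 0` and `r(1 - ∂) = ae` are covered. -/
theorem apply_X_pow_of_mul_one_sub_deriv₁ {r : I₁ K}
    (h : ∀ m : ℕ, (r * (1 - deriv₁ K)).1 (X ^ (m + 1)) = 0) (m : ℕ) :
    r.1 (X ^ m) = (m.factorial : K) • r.1 1 := by
  induction m with
  | zero => simp
  | succ m ih =>
    have h1 : r.1 ((1 - deriv₁ K).1 (X ^ (m + 1))) = 0 := h m
    rw [one_sub_deriv₁_apply, derivative_X_pow_succ, map_sub, sub_eq_zero, C_mul', map_smul, ih,
      smul_smul] at h1
    rw [h1, Nat.factorial_succ, Nat.cast_mul, Nat.cast_succ]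

theorem one_sub_deriv₁_mem_nonZeroDivisors : 1 - deriv₁ K ∈ (I₁ K)⁰ := by
  constructor
  · intro b hb
    refine I₁_ext fun m => ?_
    have h : b.1 (X ^ m) = derivative (b.1 (X ^ m)) := by
      rw [← sub_eq_zero, ← one_sub_deriv₁_apply]
      exact congrArg (fun f : I₁ K => f.1 (X ^ m)) hb
    -- A polynomial fixed by `∂` is fixed by its iterates, which eventually kill it.
    have h' : derivative^[(b.1 (X ^ m)).natDegree + 1] (b.1 (X ^ m)) = b.1 (X ^ m) :=
      Function.iterate_fixed h.symm _
    rw [← h', iterate_derivative_eq_zero (Nat.lt_succ_self _)]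
    rfl
  · intro b hb
    refine I₁_ext fun m => ?_
    have h1 : b.1 ((1 - deriv₁ K).1 1) = 0 := congrArg (fun f : I₁ K => f.1 1) hb
    rw [one_sub_deriv₁_apply, derivative_one, sub_zero] at h1
    rw [apply_X_pow_of_mul_one_sub_deriv₁ (fun m => by rw [hb]; rfl), h1, smul_zero]
    rfl

variable [CharZero K]

theorem deriv₁_mul_integral₁ : deriv₁ K * integral₁ K = 1 := by
  refine I₁_ext fun m => ?_
  change derivative (integral K (X ^ m)) = X ^ m
  rw [integral_X_pow, derivative_C_mul, derivative_X_pow_succ, ← mul_assoc, ← C_mul,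
    inv_mul_cancel₀ (Nat.cast_add_one_ne_zero m), C_1, one_mul]

theorem one_sub_integral₁_mul_deriv₁_apply (p : K[X]) :
    (1 - integral₁ K * deriv₁ K).1 p = C (p.coeff 0) := by
  change p - integral K (derivative p) = _
  induction p using Polynomial.induction_on' with
  | add p q hp hq => rw [map_add, map_add, coeff_add, C_add, ← hp, ← hq]; abel
  | monomial m c =>
    rw [← C_mul_X_pow_eq_monomial, derivative_C_mul, integral_C_mul]
    cases m with
    | zero => simp
    | succ m =>
      rw [derivative_X_pow_succ, integral_C_mul, integral_X_pow,
        ← mul_assoc (C (_ + 1)), ← C_mul (a := (m : K) + 1),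
        mul_inv_cancel₀ (Nat.cast_add_one_ne_zero m), C_1, one_mul, sub_self]
      simp

theorem one_sub_integral₁_mul_deriv₁_ne_zero : 1 - integral₁ K * deriv₁ K ≠ 0 := by
  intro h
  have h1 := one_sub_integral₁_mul_deriv₁_apply (1 : K[X])
  rw [h, coeff_one_zero, C_1] at h1
  exact zero_ne_one h1

theorem mul_one_sub_integral₁_mul_deriv₁_eq_zero (a r : I₁ K)
    (h : a * (1 - integral₁ K * deriv₁ K) = r * (1 - deriv₁ K)) :
    a * (1 - integral₁ K * deriv₁ K) = 0 := by
  have ha (p : K[X]) : (a * (1 - integral₁ K * deriv₁ K)).1 p = p.coeff 0 • a.1 1 := by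
    change a.1 ((1 - integral₁ K * deriv₁ K).1 p) = _
    rw [one_sub_integral₁_mul_deriv₁_apply, ← map_smul, smul_eq_C_mul, mul_one]
  have hr := apply_X_pow_of_mul_one_sub_deriv₁ (r := r) fun m => by
    rw [← h, ha, coeff_X_pow, if_neg (Nat.succ_ne_zero m).symm, zero_smul]
  have h1 : r.1 1 = a.1 1 := by
    have h2 : r.1 ((1 - deriv₁ K).1 1) = a.1 1 := by
      rw [← one_smul K (a.1 1), ← coeff_one_zero (R := K), ← ha, h]
      rfl
    rwa [one_sub_deriv₁_apply, derivative_one, sub_zero] at h2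
  obtain ⟨d, hd⟩ := exists_X_pow_dvd_apply r.2
  -- `xᵏ` divides `r(xᵏ⁺ᵈ) = (k + d)! a(1)`, and the factorial is invertible in characteristic zero.
  have h0 : a.1 1 = 0 := eq_zero_of_forall_X_pow_dvd fun k => by
    have h3 := hd k _ dvd_rfl
    rw [hr, h1] at h3
    have h4 := h3.mul_left (C ((k + d).factorial : K)⁻¹)
    rwa [C_mul', smul_smul, inv_mul_cancel₀ (Nat.cast_ne_zero.2 (Nat.factorial_ne_zero _)),
      one_smul] at h4
  refine I₁_ext fun m => ?_
  rw [ha, h0, smul_zero]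
  rfl

theorem one_sub_integral₁_mul_deriv₁_mul_eq_zero (a r : I₁ K)
    (h : (1 - integral₁ K * deriv₁ K) * a = (1 - mulX K) * r) :
    (1 - integral₁ K * deriv₁ K) * a = 0 := by
  refine I₁_ext fun m => ?_
  have h1 : (1 - integral₁ K * deriv₁ K).1 (a.1 (X ^ m)) = (1 - mulX K).1 (r.1 (X ^ m)) :=
    congrArg (fun f : I₁ K => f.1 (X ^ m)) h
  rw [one_sub_integral₁_mul_deriv₁_apply, one_sub_mulX_apply] at h1
  -- Evaluation at `1` keeps the constant on the left and kills the multiple of `1 - x`.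
  have h2 := congrArg (eval 1) h1
  rw [eval_C, eval_mul, eval_sub, eval_one, eval_X, sub_self, zero_mul] at h2
  change (1 - integral₁ K * deriv₁ K).1 (a.1 (X ^ m)) = 0
  rw [one_sub_integral₁_mul_deriv₁_apply, h2, C_0]

end OneVariable

/-- The map `𝕀₁ → 𝕀ₙ ⊗ A` onto the `i`-th factor. -/
noncomputable def factorHom (K : Type*) [Field K] (A : Type*) [Ring A] [Algebra K A] {n : ℕ}
    (i : Fin n) : I₁ K →ₐ[K] I K n ⊗[K] A :=
  AlgHom.comp (Algebra.TensorProduct.includeLeft : I K n →ₐ[K] I K n ⊗[K] A)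
    (PiTensorProduct.singleAlgHom (R := K) (A := fun _ : Fin n => I₁ K) i)

theorem isBimoduleSeparated_factorHom (K : Type*) [Field K] (A : Type*) [Ring A] [Algebra K A]
    {n : ℕ} (i : Fin n) : IsBimoduleSeparated (S := I₁ K) (R := I K n ⊗[K] A) (factorHom K A i) :=
  (isBimoduleSeparated_includeLeft (I K n) A).comp
    (isBimoduleSeparated_singleAlgHom (fun _ : Fin n => I₁ K) i)

theorem factorHom_ne_zero (K : Type*) [Field K] (A : Type*) [Ring A] [Algebra K A] [Nontrivial A]
    {n : ℕ} (i : Fin n) {a : I₁ K} (ha : a ≠ 0) : factorHom K A i a ≠ 0 := by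
  have h1 := singleAlgHom_ne_zero (K := K) (fun _ : Fin n => I₁ K) i ha
  exact includeLeft_ne_zero A h1

end IntegroDiff
theorem mainTheorem12 {K : Type*} [Field K] [CharZero K]
    (A : Type*) [Ring A] [Algebra K A] [Nontrivial A] (n : ℕ) (hn : 1 ≤ n) :
    -- the set of regular elements is neither left nor right Ore
    ¬ IntegroDiff.IsLeftOre (IntegroDiff.I K n ⊗[K] A)⁰ ∧
    ¬ IntegroDiff.IsRightOre (IntegroDiff.I K n ⊗[K] A)⁰ ∧
    -- the classical left and right quotient rings do not exist
    (¬ ∃ (Q : Type*) (_ : Ring Q) (f : IntegroDiff.I K n ⊗[K] A →+* Q),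
      IntegroDiff.IsLeftQuotientRing (IntegroDiff.I K n ⊗[K] A)⁰ f) ∧
    (¬ ∃ (Q : Type*) (_ : Ring Q) (f : IntegroDiff.I K n ⊗[K] A →+* Q),
      IntegroDiff.IsRightQuotientRing (IntegroDiff.I K n ⊗[K] A)⁰ f) ∧
    -- the largest left quotient ring contains an infinite direct sum of nonzero left ideals
    (∃ L : ℕ → Ideal (IntegroDiff.LeftQuotientRing (IntegroDiff.I K n ⊗[K] A)),
      (∀ i, L i ≠ ⊥) ∧ iSupIndep L) ∧
    -- the largest left quotient ring is not left Noetherian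
    ¬ IsNoetherianRing (IntegroDiff.LeftQuotientRing (IntegroDiff.I K n ⊗[K] A)) ∧
    -- the largest right quotient ring contains an infinite direct sum of nonzero right ideals
    (∃ L : ℕ → Submodule (IntegroDiff.RightQuotientRing (IntegroDiff.I K n ⊗[K] A))ᵐᵒᵖ
        (IntegroDiff.RightQuotientRing (IntegroDiff.I K n ⊗[K] A)),
      (∀ i, L i ≠ ⊥) ∧ iSupIndep L) ∧
    -- the largest right quotient ring is not right Noetherian
    ¬ IsNoetherian (IntegroDiff.RightQuotientRing (IntegroDiff.I K n ⊗[K] A))ᵐᵒᵖ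
        (IntegroDiff.RightQuotientRing (IntegroDiff.I K n ⊗[K] A)) := by
  let j := IntegroDiff.factorHom K A (⟨0, hn⟩ : Fin n)
  have hj := IntegroDiff.isBimoduleSeparated_factorHom K A (⟨0, hn⟩ : Fin n)
  have he : j (1 - IntegroDiff.integral₁ K * IntegroDiff.deriv₁ K) ≠ 0 :=
    IntegroDiff.factorHom_ne_zero K A _ IntegroDiff.one_sub_integral₁_mul_deriv₁_ne_zero
  have hL := hj.not_isLeftOre he IntegroDiff.one_sub_deriv₁_mem_nonZeroDivisors
    IntegroDiff.mul_one_sub_integral₁_mul_deriv₁_eq_zero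
  have hR := hj.not_isRightOre he IntegroDiff.one_sub_mulX_mem_nonZeroDivisors
    IntegroDiff.one_sub_integral₁_mul_deriv₁_mul_eq_zero
  obtain ⟨E, hE, hE0⟩ := IntegroDiff.exists_orthogonalIdempotents_of_mul_eq_one
    (S := IntegroDiff.I₁ K) (R := IntegroDiff.I K n ⊗[K] A) j
    IntegroDiff.deriv₁_mul_integral₁ he
  have hQl := IntegroDiff.exists_iSupIndep_leftQuotientRing hE hE0
  have hQr := IntegroDiff.exists_iSupIndep_rightQuotientRing hE hE0
  refine ⟨hL, hR, fun ⟨_, _, _, hf⟩ => hL hf.isLeftOre, fun ⟨_, _, _, hf⟩ => hR hf.isRightOre,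
    hQl, ?_, hQr, ?_⟩
  · obtain ⟨L, h0, hind⟩ := hQl
    exact IntegroDiff.not_isNoetherian_of_iSupIndep h0 hind
  · obtain ⟨L, h0, hind⟩ := hQr
    exact IntegroDiff.not_isNoetherian_of_iSupIndep h0 hind
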